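/- Let $G$ be a finite simple connected undirected graph with vertex set $V$ and adjacency matrix $A$. For a finite graph $H$ with adjacency matrix $A_H$ let $U_H(t)=\exp(-itA_H)$ for $t\in\mathbb R$. For an eigenvalue $\lambda$ of $A$ let $E_\lambda$ be the orthogonal projection onto the corresponding eigenspace, and for a vertex $u$ let $$\sigma_u(G)=\{\lambda : \lambda \text{ is an eigenvalue of } A \text{ and } E_\lambda \mathbf e_u\neq 0\}$$ be the eigenvalue support of $u$. Let $\overset{2}{\uplus}G$ be the blow-up of two copies of $G$: its vertex set is $\mathbb Z_2\times V$, and $(l,v)$ and $(m,w)$ are adjacent if and only if $v$ and $w$ are adjacent in $G$. A graph $H$ exhibits pretty good state transfer (PGST) between vertices $x$ and $y$ with phase factor $\gamma$, $|\gamma|=1$, if there is a real sequence $(\tau_k)$ with $\lim_{k\to\infty}U_H(\tau_k)_{x,y}=\gamma$; and $H$ is almost periodic at $x$ with phase factor $\gamma$, $|\gamma|=1$, if there is a real sequence $(\tau_k)$ with $\lim_{k\to\infty}U_H(\tau_k)_{x,x}=\gamma$. Theorem. Let $u$ be a vertex of $G$ with $0\notin\sigma_u(G)$, and write $\sigma_u(G)=\{\lambda_j\}_{j}$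 with distinct $\lambda_j$. The following are equivalent. 1. The graph $\overset{2}{\uplus}G$ exhibits PGST between $(0,u)$ and $(1,u)$ with phase factor $\gamma=-1$. 2. There is a real sequence $(\tau_k)$ such that $\lim_{k\to\infty}\exp(-2i\lambda\tau_k)=-1$ for each $\lambda\in\sigma_u(G)$. 3. $G$ is almost periodic at $u$ with phase factor $\gamma=-1$. 4. If $m_j$ are integers such that $\sum_{\lambda_j\in\sigma_u(G)}m_j\lambda_j=0$, then $\sum_{\lambda_j\in\sigma_u(G)}m_j$ is even. -/

import Mathlib

open Filter Topology

/-- The blow-up of `n` copies of `G`: vertex set `ℤ/n × V`, with `(l, u)` adjacent to `(m, v)`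
iff `u` is adjacent to `v` in `G`. -/
def blowUp {V : Type*} (n : ℕ) (G : SimpleGraph V) : SimpleGraph (ZMod n × V) where
  Adj a b := G.Adj a.2 b.2
  symm := ⟨fun _ _ h => SimpleGraph.Adj.symm h⟩
  loopless := ⟨fun a h => G.irrefl (v := a.2) h⟩

open Classical in
/-- The transition matrix `U(t) = exp(-i t A)` of the continuous-time quantum walk on `G`, where
`A` is the adjacency matrix of `G`. -/
noncomputable def transitionMatrix {V : Type*} [Fintype V] (G : SimpleGraph V) (t : ℝ) :
    Matrix V V ℂ :=
  NormedSpace.exp ((-(Complex.I * (t : ℂ))) • G.adjMatrix ℂ)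

/-- Pretty good state transfer between `u` and `v` with phase factor `γ`, `|γ| = 1`:
`U(τ k)_{u,v} → γ` along some real sequence `τ`. -/
def HasPGSTWithPhase {V : Type*} [Fintype V] (G : SimpleGraph V) (u v : V) (γ : ℂ) : Prop :=
  ‖γ‖ = 1 ∧ ∃ τ : ℕ → ℝ, Tendsto (fun k => transitionMatrix G (τ k) u v) atTop (𝓝 γ)

/-- `G` is almost periodic at `u` with phase factor `γ`, `|γ| = 1`:
`U(τ k)_{u,u} → γ` along some real sequence `τ`. -/
def IsAlmostPeriodicAtWithPhase {V : Type*} [Fintype V] (G : SimpleGraph V) (u : V) (γ : ℂ) :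
    Prop :=
  ‖γ‖ = 1 ∧ ∃ τ : ℕ → ℝ, Tendsto (fun k => transitionMatrix G (τ k) u u) atTop (𝓝 γ)

open Classical in
/-- The adjacency matrix of `G` as an operator on the Euclidean space `ℝ^V`. -/
noncomputable def adjOperator {V : Type*} [Fintype V] (G : SimpleGraph V) :
    Module.End ℝ (EuclideanSpace ℝ V) :=
  Matrix.toEuclideanLin (G.adjMatrix ℝ)

/-- The idempotent `E_μ`: the orthogonal projection of `ℝ^V` onto the `μ`-eigenspace of the
adjacency matrix. -/
noncomputable def eigenIdempotent {V : Type*} [Fintype V] (G : SimpleGraph V) (μ : ℝ) :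
    EuclideanSpace ℝ V →L[ℝ] EuclideanSpace ℝ V :=
  ((adjOperator G).eigenspace μ).starProjection

open Classical in
/-- The eigenvalue support of `u`: the eigenvalues `μ` of `G` with `E_μ e_u ≠ 0`. -/
def eigenvalueSupport {V : Type*} [Fintype V] (G : SimpleGraph V) (u : V) : Set ℝ :=
  {μ | (adjOperator G).HasEigenvalue μ ∧ eigenIdempotent G μ (EuclideanSpace.single u 1) ≠ 0}

theorem eigenvalueSupport_finite {V : Type*} [Fintype V] (G : SimpleGraph V) (u : V) :
    (eigenvalueSupport G u).Finite :=
  (Module.End.finite_hasEigenvalue (adjOperator G)).subset fun _ h => h.1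

/-!
In an orthonormal basis of eigenvectors, the diagonal entry `U(t)_{u,u}` of the transition matrix
is a convex combination of the phases `exp(-i t μ)` in which exactly the `μ` in the eigenvalue
support of `u` carry positive weight. Since `-1` is an extreme point of the unit disc, such
combinations tend to `-1` if and only if each phase does
(`tendsto_transitionMatrix_apply_self_neg_one_iff`). This turns almost periodicity into a
simultaneous approximation problem. State transfer in the blow-up reduces to almost periodicity
because its amplitude between the two copies of `u` is `(U(2t)_{u,u} - 1) / 2`
(`transitionMatrix_blowUp_two`).

The approximation problem is settled by Kronecker's theorem (`kronecker_exists_tendsto`): the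
phases can be brought simultaneously near `-1` unless an integer relation among the eigenvalues
forbids it, that is, a relation with odd coefficient sum. Kronecker's theorem itself follows from
the fact that a closed subgroup of a torus is the common kernel of the characters trivial on it
(`AddSubgroup.mem_of_forall_mFourier_eq_one`), applied to the closure of a one-parameter subgroup.
-/

/-! ### Closed subgroups of the torus and Kronecker's theorem -/

open MeasureTheory UnitAddTorus in
/-- A closed subgroup `H` of the torus is cut out by the characters that are trivial on it. If
`x` satisfies every equation `mFourier n x = 1` that holds on `H`, then Haar averages over `H` and
over the coset `x + H` agree on characters, hence on all continuous functions, so no Urysohn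
function separates `x + H` from `H`. -/
theorem AddSubgroup.mem_of_forall_mFourier_eq_one {d : Type*} [Fintype d]
    {H : AddSubgroup (UnitAddTorus d)} (hH : IsClosed (H : Set (UnitAddTorus d)))
    {x : UnitAddTorus d}
    (hx : ∀ n : d → ℤ, (∀ h ∈ H, mFourier n h = 1) → mFourier n x = 1) : x ∈ H := by
  have : CompactSpace H := isCompact_iff_compactSpace.mp hH.isCompact
  let _ : MeasurableSpace H := borel H
  have : BorelSpace H := ⟨rfl⟩
  let μ : Measure H := Measure.addHaar
  -- `r y` parametrizes the coset `y + H`.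
  let r (y : UnitAddTorus d) : C(H, UnitAddTorus d) := ⟨fun h => y + h, by fun_prop⟩
  have hint (y : UnitAddTorus d) (f : C(UnitAddTorus d, ℂ)) : Integrable (fun h => f (r y h)) μ :=
    (f.comp (r y)).continuous.integrable_of_hasCompactSupport
      (HasCompactSupport.of_compactSpace _)
  have hcont (y : UnitAddTorus d) :
      Continuous fun f : C(UnitAddTorus d, ℂ) => ∫ h, f (r y h) ∂μ := by
    have : LipschitzWith (μ.real Set.univ).toNNReal
        fun f : C(UnitAddTorus d, ℂ) => ∫ h, f (r y h) ∂μ := by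
      refine LipschitzWith.of_dist_le_mul fun f g => ?_
      rw [dist_eq_norm, ← integral_sub (hint y f) (hint y g), mul_comm,
        Real.coe_toNNReal _ measureReal_nonneg]
      refine norm_integral_le_of_norm_le_const (.of_forall fun h => ?_)
      rw [← dist_eq_norm]
      exact ContinuousMap.dist_apply_le_dist _
    exact this.continuous
  have hchar (n : d → ℤ) : ∫ h, mFourier n (r x h) ∂μ = ∫ h, mFourier n (r 0 h) ∂μ := by
    have hadd (a b : UnitAddTorus d) : mFourier n (a + b) = mFourier n a * mFourier n b := by
      simp [mFourier, fourier_apply, Finset.prod_mul_distrib, smul_add, AddCircle.toCircle_add]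
    have hmul (y : UnitAddTorus d) :
        ∫ h, mFourier n (r y h) ∂μ =
          mFourier n y * ∫ h : H, mFourier n (h : UnitAddTorus d) ∂μ := by
      simp [r, hadd, integral_const_mul]
    by_cases hn : ∀ h ∈ H, mFourier n h = 1
    · rw [hmul, hmul, hx n hn, hn 0 H.zero_mem]
    · push Not at hn
      obtain ⟨a, ha, hna⟩ := hn
      -- A character that is nontrivial on `H` has mean zero over `H`, by invariance.
      have h0 : ∫ h : H, mFourier n (h : UnitAddTorus d) ∂μ = 0 := by
        have h1 := integral_add_left_eq_self (μ := μ)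
          (fun h : H => mFourier n (h : UnitAddTorus d)) ⟨a, ha⟩
        have h2 := hmul a
        simp only [AddSubgroup.coe_add] at h1
        simp only [r, ContinuousMap.coe_mk] at h2
        rw [h1] at h2
        by_contra h3
        exact hna (mul_right_cancel₀ h3 (by rw [one_mul, ← h2]))
      rw [hmul, hmul, h0, mul_zero, mul_zero]
  have hall (f : C(UnitAddTorus d, ℂ)) : ∫ h, f (r x h) ∂μ = ∫ h, f (r 0 h) ∂μ := by
    have hf : f ∈ (Submodule.span ℂ (Set.range (mFourier (d := d)))).topologicalClosure := by
      rw [span_mFourier_closure_eq_top]; trivial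
    refine closure_minimal (t := {f | ∫ h, f (r x h) ∂μ = ∫ h, f (r 0 h) ∂μ})
      (fun g hg => ?_) (isClosed_eq (hcont x) (hcont 0)) hf
    induction hg using Submodule.span_induction with
    | mem g hg => obtain ⟨n, rfl⟩ := hg; exact hchar n
    | zero => simp
    | add f g _ _ hf hg =>
      simp only [Set.mem_ofPred_eq, ContinuousMap.add_apply] at *
      rw [integral_add (hint x f) (hint x g), integral_add (hint 0 f) (hint 0 g), hf, hg]
    | smul c f _ hf =>
      simp only [Set.mem_ofPred_eq, ContinuousMap.smul_apply] at *
      rw [integral_smul, integral_smul, hf]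
  by_contra hxH
  have hdisj : Disjoint (Set.range (r x)) (H : Set (UnitAddTorus d)) := by
    rw [Set.disjoint_left]
    rintro _ ⟨h, rfl⟩ hh
    exact hxH ((H.add_mem_cancel_right h.2).mp hh)
  obtain ⟨f, hf0, hf1, -⟩ := exists_continuous_zero_one_of_isClosed
    (isCompact_range (r x).continuous).isClosed hH hdisj
  have h := hall ⟨fun y => (f y : ℂ), by fun_prop⟩
  have h0 (h : H) : f (r x h) = 0 := hf0 ⟨h, rfl⟩
  have h1 (h : H) : f (r 0 h) = 1 := hf1 (by simp [r])
  have hμ : μ.real Set.univ ≠ 0 := ENNReal.toReal_ne_zero.mpr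
    ⟨Measure.measure_univ_ne_zero.mpr (NeZero.ne μ), measure_ne_top _ _⟩
  simp only [ContinuousMap.coe_mk, h0, h1] at h
  rw [Complex.ofReal_zero, Complex.ofReal_one, integral_zero, integral_const] at h
  simp only [Complex.real_smul, mul_one] at h
  exact hμ (by exact_mod_cast h.symm)

/-- **Kronecker's theorem**, in exponential form: if every integer relation among the `l i` is
satisfied modulo `1` by the `a i`, then the points `(l i * t)`, `t` real, approach `(a i)`
modulo `1`. -/
theorem kronecker_exists_tendsto {ι : Type*} [Fintype ι] (l a : ι → ℝ)
    (h : ∀ n : ι → ℤ, ∑ i, n i * l i = 0 → ∃ k : ℤ, ∑ i, n i * a i = k) :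
    ∃ t : ℕ → ℝ, ∀ i, Tendsto (fun k => Complex.exp (2 * Real.pi * Complex.I * (l i * t k : ℝ)))
      atTop (𝓝 (Complex.exp (2 * Real.pi * Complex.I * a i))) := by
  let φ : ℝ →+ UnitAddTorus ι :=
    { toFun := fun t i => ((l i * t : ℝ) : UnitAddCircle)
      map_zero' := by ext; simp
      map_add' := fun a b => by ext; simp [mul_add] }
  let x : UnitAddTorus ι := fun i => (a i : UnitAddCircle)
  have hchar (n : ι → ℤ) (v : ι → ℝ) : UnitAddTorus.mFourier n (fun i => (v i : UnitAddCircle)) =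
      Complex.exp (2 * Real.pi * Complex.I * (∑ i, n i * v i : ℝ)) := by
    simp only [UnitAddTorus.mFourier, ContinuousMap.coe_mk, fourier_coe_apply,
      ← Complex.exp_sum]
    push_cast
    rw [Finset.mul_sum]
    exact congrArg _ (Finset.sum_congr rfl fun i _ => by ring)
  have hx : x ∈ φ.range.topologicalClosure := by
    refine AddSubgroup.mem_of_forall_mFourier_eq_one
      (AddSubgroup.isClosed_topologicalClosure _) fun n hn => ?_
    have hn' (t : ℝ) : Complex.exp (2 * Real.pi * Complex.I * ((∑ i, n i * l i) * t : ℝ)) = 1 := by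
      rw [← hn (φ t) (AddSubgroup.le_topologicalClosure _ ⟨t, rfl⟩), Finset.sum_mul]
      simp_rw [mul_assoc (n _ : ℝ)]
      exact (hchar n _).symm
    have h0 : ∑ i, n i * l i = 0 := by
      by_contra hne
      -- At this time the phase would be a half-turn, with value `-1`.
      have h1 := hn' (1 / 2 / ∑ i, n i * l i)
      rw [mul_div_cancel₀ _ hne] at h1
      have : (2 * Real.pi * Complex.I * ((1 / 2 : ℝ) : ℂ)) = Real.pi * Complex.I := by
        push_cast; ring
      rw [this, Complex.exp_pi_mul_I] at h1
      norm_num at h1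
    obtain ⟨k, hk⟩ := h n h0
    rw [hchar, hk, Complex.exp_eq_one_iff]
    exact ⟨k, by push_cast; ring⟩
  obtain ⟨y, hy, hlim⟩ := mem_closure_iff_seq_limit.mp hx
  choose t ht using hy
  refine ⟨t, fun i => ?_⟩
  have hc : Continuous fun z : UnitAddTorus ι => fourier 1 (z i) := by fun_prop
  have hl := (hc.tendsto x).comp hlim
  simp only [Function.comp_def, ← ht] at hl
  change Tendsto (fun k => fourier 1 ((l i * t k : ℝ) : UnitAddCircle)) atTop
    (𝓝 (fourier 1 (a i : UnitAddCircle))) at hl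
  simpa only [fourier_coe_apply, Int.cast_one, mul_one, Complex.ofReal_one, div_one] using hl

/-! ### Spectral expansion of the transition matrix -/

open Classical in
theorem isHermitian_adjMatrix {V : Type*} [Fintype V] (G : SimpleGraph V) :
    (G.adjMatrix ℝ).IsHermitian := by
  simp [Matrix.IsHermitian, Matrix.conjTranspose_eq_transpose_of_trivial]

/-- The diagonal entries of the transition matrix, expanded in an orthonormal basis of real
eigenvectors of the adjacency matrix. -/
theorem transitionMatrix_apply_self {V : Type*} [Fintype V] [DecidableEq V] (G : SimpleGraph V)
    (t : ℝ) (u : V) :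
    transitionMatrix G t u u = ∑ i, (((isHermitian_adjMatrix G).eigenvectorBasis i u ^ 2 : ℝ) : ℂ) *
      Complex.exp (-(Complex.I * t) * (isHermitian_adjMatrix G).eigenvalues i) := by
  obtain rfl : ‹DecidableEq V› = Classical.decEq V := Subsingleton.elim _ _
  classical
  set hA := isHermitian_adjMatrix G
  set P : Matrix V V ℝ := (hA.eigenvectorUnitary : Matrix V V ℝ)
  have hP : P * star P = 1 := Unitary.coe_mul_star_self _
  let Q : Matrix V V ℂ := P.map (Complex.ofRealHom)
  let R : Matrix V V ℂ := (star P).map (Complex.ofRealHom)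
  have hQR : Q * R = 1 := by
    simp only [Q, R]
    rw [← Matrix.map_mul, hP]
    simp
  have hinv : Q⁻¹ = R := Matrix.inv_eq_right_inv hQR
  have hspec : G.adjMatrix ℂ = Q * Matrix.diagonal (fun i => (hA.eigenvalues i : ℂ)) * Q⁻¹ := by
    have h := hA.spectral_theorem
    rw [Unitary.conjStarAlgAut_apply] at h
    have h2 := congrArg (fun M : Matrix V V ℝ => M.map Complex.ofRealHom) h
    simp only [Matrix.map_mul] at h2
    rw [hinv]
    convert h2 using 1
    · ext i j; simp [SimpleGraph.adjMatrix_apply, apply_ite]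
    · congr 2
      rw [Matrix.diagonal_map (map_zero _)]
      rfl
  have hsmul : (-(Complex.I * (t : ℂ))) • G.adjMatrix ℂ =
      Q * Matrix.diagonal (fun i => -(Complex.I * t) * (hA.eigenvalues i : ℂ)) * Q⁻¹ := by
    rw [hspec, ← Matrix.smul_mul, ← Matrix.mul_smul, ← Matrix.diagonal_smul]
    rfl
  have hU : IsUnit Q := IsUnit.of_mul_eq_one _ hQR
  unfold transitionMatrix
  rw [hsmul, Matrix.exp_conj _ _ hU, Matrix.exp_diagonal, hinv, Matrix.mul_apply]
  refine Finset.sum_congr rfl fun i _ => ?_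
  rw [Matrix.mul_diagonal, Pi.coe_exp, ← Complex.exp_eq_exp_ℂ]
  simp [Q, R, P]
  ring

/-- An eigenvalue lies in the support of `u` exactly when some member of the chosen orthonormal
eigenbasis belongs to it and does not vanish at `u`. -/
theorem mem_eigenvalueSupport_iff {V : Type*} [Fintype V] [DecidableEq V] (G : SimpleGraph V)
    (u : V) (μ : ℝ) :
    μ ∈ eigenvalueSupport G u ↔ ∃ i, (isHermitian_adjMatrix G).eigenvalues i = μ ∧
      (isHermitian_adjMatrix G).eigenvectorBasis i u ≠ 0 := by
  obtain rfl : ‹DecidableEq V› = Classical.decEq V := Subsingleton.elim _ _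
  classical
  set hA := isHermitian_adjMatrix G
  have hb (i : V) : adjOperator G (hA.eigenvectorBasis i) =
      hA.eigenvalues i • hA.eigenvectorBasis i := by
    ext j
    have := congrFun (hA.mulVec_eigenvectorBasis i) j
    simpa [adjOperator, Matrix.toLpLin_apply] using this
  have hsymm : (adjOperator G).IsSymmetric := Matrix.isSymmetric_toEuclideanLin_iff.mpr hA
  have hperp : eigenIdempotent G μ (EuclideanSpace.single u 1) = 0 ↔
      ∀ v ∈ (adjOperator G).eigenspace μ, v u = 0 := by
    rw [eigenIdempotent, Submodule.starProjection_apply_eq_zero_iff, Submodule.mem_orthogonal]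
    simp [EuclideanSpace.inner_single_right]
  -- In the forward direction, an eigenvector for `μ` only involves basis vectors for `μ`.
  constructor
  · rintro ⟨-, hne⟩
    by_contra! hcon
    refine hne (hperp.mpr fun v hv => ?_)
    rw [← hA.eigenvectorBasis.sum_repr v]
    simp only [WithLp.ofLp_sum, Finset.sum_apply, PiLp.smul_apply, smul_eq_mul]
    refine Finset.sum_eq_zero fun i _ => ?_
    by_cases hi : hA.eigenvalues i = μ
    · rw [hcon i hi, mul_zero]
    · have h1 := hsymm (hA.eigenvectorBasis i) v
      rw [Module.End.mem_eigenspace_iff.mp hv, hb, inner_smul_left, inner_smul_right] at h1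
      rw [hA.eigenvectorBasis.repr_apply_apply]
      have : inner ℝ (hA.eigenvectorBasis i) v = 0 := by
        by_contra h2
        exact hi (mul_right_cancel₀ h2 h1)
      rw [this, zero_mul]
  · rintro ⟨i, rfl, hi⟩
    have hmem := Module.End.mem_eigenspace_iff.mpr (hb i)
    refine ⟨Module.End.hasEigenvalue_of_hasEigenvector
      ⟨hmem, hA.eigenvectorBasis.orthonormal.ne_zero i⟩, fun h => hi (hperp.mp h _ hmem)⟩

theorem sum_eigenvectorBasis_sq {V : Type*} [Fintype V] [DecidableEq V] (G : SimpleGraph V)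
    (u : V) :
    ∑ i, (isHermitian_adjMatrix G).eigenvectorBasis i u ^ 2 = 1 := by
  have h := (isHermitian_adjMatrix G).eigenvectorBasis.sum_sq_norm_inner_right
    (EuclideanSpace.single u (1 : ℝ))
  simpa [EuclideanSpace.inner_single_right] using h

/-- The point `-1` is extreme in the unit disc: convex combinations of unit complex numbers
approach it if and only if every term of nonzero weight does. -/
theorem tendsto_sum_mul_neg_one_iff {ι α : Type*} [Fintype ι] {F : Filter α} {p : ι → ℝ}
    (hp : ∀ i, 0 ≤ p i) (hsum : ∑ i, p i = 1) {z : α → ι → ℂ} (hz : ∀ k i, ‖z k i‖ = 1) :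
    Tendsto (fun k => ∑ i, (p i : ℂ) * z k i) F (𝓝 (-1)) ↔
      ∀ i, p i ≠ 0 → Tendsto (fun k => z k i) F (𝓝 (-1)) := by
  constructor
  · intro h i hi
    have hre (k : α) (j : ι) : 0 ≤ 1 + (z k j).re := by
      have := Complex.abs_re_le_norm (z k j)
      rw [hz, abs_le] at this
      linarith
    have h1 : Tendsto (fun k => ∑ j, p j * (1 + (z k j).re)) F (𝓝 0) := by
      have := ((Complex.continuous_re.tendsto _).comp h).const_add 1
      simpa [mul_add, Finset.sum_add_distrib, hsum, Function.comp_def] using this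
    have h2 : Tendsto (fun k => p i * (1 + (z k i).re)) F (𝓝 0) :=
      squeeze_zero (fun k => mul_nonneg (hp i) (hre k i))
        (fun k => Finset.single_le_sum (f := fun j => p j * (1 + (z k j).re))
          (fun j _ => mul_nonneg (hp j) (hre k j)) (Finset.mem_univ i)) h1
    -- For `‖z‖ = 1` one has `‖z + 1‖ ^ 2 = 2 * (1 + re z)`.
    have h3 : Tendsto (fun k => √(2 / p i * (p i * (1 + (z k i).re)))) F (𝓝 0) := by
      simpa using (h2.const_mul (2 / p i)).sqrt
    rw [tendsto_iff_norm_sub_tendsto_zero]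
    refine h3.congr fun k => ?_
    have h4 := hz k i
    rw [← sq_eq_sq₀ (norm_nonneg _) zero_le_one, Complex.sq_norm, Complex.normSq_apply] at h4
    rw [Complex.norm_def, Complex.normSq_apply]
    congr 1
    field_simp
    simp
    linarith
  · intro h
    have : Tendsto (fun k => ∑ i, (p i : ℂ) * z k i) F (𝓝 (∑ i, (p i : ℂ) * (-1))) := by
      refine tendsto_finsetSum _ fun i _ => ?_
      by_cases hi : p i = 0
      · simpa [hi] using tendsto_const_nhds
      · exact (h i hi).const_mul _
    rw [← Finset.sum_mul, ← Complex.ofReal_sum, hsum] at this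
    simpa using this

theorem tendsto_transitionMatrix_apply_self_neg_one_iff {V α : Type*} [Fintype V]
    (G : SimpleGraph V) (u : V) {F : Filter α} (τ : α → ℝ) :
    Tendsto (fun k => transitionMatrix G (τ k) u u) F (𝓝 (-1)) ↔
      ∀ μ ∈ eigenvalueSupport G u,
        Tendsto (fun k => Complex.exp (-(Complex.I * τ k) * μ)) F (𝓝 (-1)) := by
  classical
  simp_rw [transitionMatrix_apply_self]
  rw [tendsto_sum_mul_neg_one_iff (fun i => sq_nonneg _) (sum_eigenvectorBasis_sq G u)
    fun k i => by
      rw [show -(Complex.I * τ k) * ((isHermitian_adjMatrix G).eigenvalues i : ℂ) =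
        (-(τ k * (isHermitian_adjMatrix G).eigenvalues i) : ℝ) * Complex.I by push_cast; ring]
      exact Complex.norm_exp_ofReal_mul_I _]
  simp only [mem_eigenvalueSupport_iff]
  constructor
  · rintro h μ ⟨i, rfl, hi⟩
    exact h i (pow_ne_zero 2 hi)
  · exact fun h i hi => h _ ⟨i, rfl, fun h0 => hi (by rw [h0]; norm_num)⟩

/-! ### The blow-up of two copies -/

/-- The transition amplitude between two copies of `u` in the blow-up. The adjacency matrix of the
blow-up is `J ⊗ A`, with `J` the all-ones matrix of size two; `J / 2` and `1 - J / 2` are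
complementary idempotents, so `J ⊗ A` acts as `2 A` on one summand and as `0` on the other. -/
theorem transitionMatrix_blowUp_two {V : Type*} [Fintype V] [DecidableEq V] (G : SimpleGraph V)
    (t : ℝ) (u : V) :
    transitionMatrix (blowUp 2 G) t (0, u) (1, u) = (transitionMatrix G (2 * t) u u - 1) / 2 := by
  classical
  have hsum2 (g : ZMod 2 → ℂ) : ∑ i, g i = g 0 + g 1 := Fin.sum_univ_two g
  have h01 : ∀ i : ZMod 2, i = 0 ∨ i = 1 := by decide
  -- `f (M, N) = J / 2 ⊗ M + (1 - J / 2) ⊗ N`, a ring homomorphism, so it commutes with `exp`.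
  let f : Matrix V V ℂ × Matrix V V ℂ →+* Matrix (ZMod 2 × V) (ZMod 2 × V) ℂ :=
    { toFun := fun M => Matrix.of fun x y =>
        if x.1 = y.1 then (M.1 x.2 y.2 + M.2 x.2 y.2) / 2 else (M.1 x.2 y.2 - M.2 x.2 y.2) / 2
      map_zero' := by ext; simp
      map_one' := by
        ext ⟨i, v⟩ ⟨j, w⟩
        simp [Matrix.one_apply]
        grind
      map_add' := fun M N => by
        ext ⟨i, v⟩ ⟨j, w⟩
        simp
        split_ifs <;> ring
      map_mul' := fun M N => by
        ext ⟨i, v⟩ ⟨j, w⟩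
        simp only [Matrix.mul_apply, Matrix.of_apply, Prod.fst_mul, Prod.snd_mul,
          Fintype.sum_prod_type, ← Finset.sum_add_distrib, ← Finset.sum_sub_distrib,
          Finset.sum_div]
        rw [Finset.sum_comm]
        simp only [hsum2]
        rcases h01 i with rfl | rfl <;> rcases h01 j with rfl | rfl <;>
          simp only [zero_ne_one, one_ne_zero, if_true, if_false] <;>
          exact Finset.sum_congr rfl fun k _ => by ring }
  have hf : Continuous f := by
    refine continuous_matrix fun x y => ?_
    change Continuous fun M : Matrix V V ℂ × Matrix V V ℂ =>
      if x.1 = y.1 then (M.1 x.2 y.2 + M.2 x.2 y.2) / 2 else (M.1 x.2 y.2 - M.2 x.2 y.2) / 2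
    split_ifs <;> fun_prop
  have hadj : (-(Complex.I * (t : ℂ))) • (blowUp 2 G).adjMatrix ℂ =
      f ((-(Complex.I * ((2 * t : ℝ) : ℂ))) • G.adjMatrix ℂ, 0) := by
    ext ⟨i, v⟩ ⟨j, w⟩
    have hentry : (blowUp 2 G).adjMatrix ℂ (i, v) (j, w) = G.adjMatrix ℂ v w := by
      rw [SimpleGraph.adjMatrix_apply, SimpleGraph.adjMatrix_apply]
      exact if_congr Iff.rfl rfl rfl
    simp only [f, Matrix.smul_apply, hentry, smul_eq_mul, RingHom.coe_mk, MonoidHom.coe_mk,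
      OneHom.coe_mk, Matrix.of_apply, Matrix.zero_apply]
    push_cast
    split_ifs <;> ring
  -- The exponential does not depend on a norm, but `map_exp` needs one. Stating its consequences
  -- through `E` keeps the choice of matrix norm out of the rest of the proof.
  obtain ⟨E, hE, hE1, hE2⟩ : ∃ E : Matrix V V ℂ × Matrix V V ℂ,
      f E = NormedSpace.exp ((-(Complex.I * (t : ℂ))) • (blowUp 2 G).adjMatrix ℂ) ∧
      E.1 = NormedSpace.exp ((-(Complex.I * ((2 * t : ℝ) : ℂ))) • G.adjMatrix ℂ) ∧
      E.2 = NormedSpace.exp 0 := by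
    rw [hadj]
    open scoped Matrix.Norms.Operator in
    exact ⟨NormedSpace.exp ((-(Complex.I * ((2 * t : ℝ) : ℂ))) • G.adjMatrix ℂ, 0),
      NormedSpace.map_exp f hf _, Prod.fst_exp _, Prod.snd_exp _⟩
  have h1 : transitionMatrix (blowUp 2 G) t = f E := by
    rw [hE]
    unfold transitionMatrix
    congr!
  have h2 : transitionMatrix G (2 * t) = E.1 := by
    rw [hE1]
    unfold transitionMatrix
    congr!
  rw [h1, h2]
  simp [f, hE2]

theorem tendsto_transitionMatrix_blowUp_two_iff {V α : Type*} [Fintype V] (G : SimpleGraph V)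
    (u : V) {F : Filter α} (τ : α → ℝ) :
    Tendsto (fun k => transitionMatrix (blowUp 2 G) (τ k) (0, u) (1, u)) F (𝓝 (-1)) ↔
      Tendsto (fun k => transitionMatrix G (2 * τ k) u u) F (𝓝 (-1)) := by
  classical
  simp_rw [transitionMatrix_blowUp_two]
  constructor
  · intro h
    convert (h.const_mul 2).add_const 1 using 2
    · ring
    · norm_num
  · intro h
    convert (h.sub_const 1).div_const 2 using 2
    norm_num

/-! ### Phases near `-1` and parity of integer relations -/

/-- Raising the limits to the powers `m μ` and multiplying turns a vanishing combination of the
frequencies into the equation `1 = (-1) ^ ∑ m μ`. -/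
theorem even_sum_of_tendsto_exp_neg_one {α : Type*} {F : Filter α} [F.NeBot] {s : Finset ℝ}
    {τ : α → ℝ} {c : ℂ}
    (hτ : ∀ μ ∈ s, Tendsto (fun k => Complex.exp (c * μ * τ k)) F (𝓝 (-1)))
    {m : ℝ → ℤ} (hm : ∑ μ ∈ s, (m μ : ℝ) * μ = 0) : Even (∑ μ ∈ s, m μ) := by
  have h1 : Tendsto (fun k => ∏ μ ∈ s, Complex.exp (c * μ * τ k) ^ m μ) F
      (𝓝 (∏ μ ∈ s, (-1) ^ m μ)) :=
    tendsto_finsetProd _ fun μ hμ => (hτ μ hμ).zpow₀ _ (Or.inl (by norm_num))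
  have hm' : ∑ μ ∈ s, (m μ : ℂ) * μ = 0 := by exact_mod_cast congrArg Complex.ofReal hm
  have h2 (k : α) : ∏ μ ∈ s, Complex.exp (c * μ * τ k) ^ m μ = 1 := by
    simp_rw [← Complex.exp_int_mul, ← Complex.exp_sum]
    rw [Complex.exp_eq_one_iff]
    refine ⟨0, ?_⟩
    calc ∑ μ ∈ s, (m μ : ℂ) * (c * μ * τ k) = (∑ μ ∈ s, (m μ : ℂ) * μ) * (c * τ k) := by
          rw [Finset.sum_mul]; exact Finset.sum_congr rfl fun μ _ => by ring
      _ = _ := by rw [hm']; simp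
  simp_rw [h2] at h1
  have h3 := tendsto_nhds_unique h1 tendsto_const_nhds
  have h4 : ∏ μ ∈ s, (-1 : ℂ) ^ m μ = (-1) ^ ∑ μ ∈ s, m μ := by
    clear * -
    induction s using Finset.induction_on with
    | empty => simp
    | insert a s ha ih => rw [Finset.prod_insert ha, Finset.sum_insert ha, ih,
        zpow_add₀ (by norm_num)]
  rw [h4] at h3
  by_contra h5
  rw [(Int.not_even_iff_odd.mp h5).neg_one_zpow] at h3
  norm_num at h3

/-- Kronecker's theorem with all targets equal to `1 / 2`: an integer relation with coefficients
`m` is then respected modulo `1` exactly when `∑ m μ` is even. -/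
theorem exists_tendsto_exp_neg_one_of_even_sum {s : Finset ℝ}
    (h : ∀ m : ℝ → ℤ, ∑ μ ∈ s, (m μ : ℝ) * μ = 0 → Even (∑ μ ∈ s, m μ)) :
    ∃ τ : ℕ → ℝ, ∀ μ ∈ s,
      Tendsto (fun k => Complex.exp (-2 * Complex.I * μ * τ k)) atTop (𝓝 (-1)) := by
  obtain ⟨t, ht⟩ := kronecker_exists_tendsto (fun μ : s => (μ : ℝ)) (fun _ => 1 / 2) fun n hn => by
    have hext (μ : s) : Function.extend Subtype.val n 0 (μ : ℝ) = n μ :=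
      Subtype.val_injective.extend_apply n 0 μ
    obtain ⟨k, hk⟩ := h (Function.extend Subtype.val n 0) (by
      rw [← Finset.sum_coe_sort]; simpa only [hext] using hn)
    rw [← Finset.sum_coe_sort] at hk
    simp only [hext] at hk
    refine ⟨k, ?_⟩
    rw [← Finset.sum_mul, ← Int.cast_sum, hk]
    push_cast; ring
  -- The rescaling turns the phase `2 * π * μ * t` into `-2 * μ * τ`.
  refine ⟨fun k => -(Real.pi * t k), fun μ hμ => ?_⟩
  have hlim := ht ⟨μ, hμ⟩
  rw [show 2 * Real.pi * Complex.I * ((1 / 2 : ℝ) : ℂ) = Real.pi * Complex.I by push_cast; ring,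
    Complex.exp_pi_mul_I] at hlim
  refine hlim.congr fun k => ?_
  push_cast
  ring_nf

theorem mainTheorem2 {V : Type*} [Fintype V] (G : SimpleGraph V) (hG : G.Connected) (u : V)
    (hu : (0 : ℝ) ∉ eigenvalueSupport G u) :
    List.TFAE [
      HasPGSTWithPhase (blowUp 2 G) (0, u) (1, u) (-1),
      ∃ τ : ℕ → ℝ, ∀ μ ∈ eigenvalueSupport G u,
        Tendsto (fun k => Complex.exp (-2 * Complex.I * (μ : ℂ) * (τ k : ℂ))) atTop (𝓝 (-1)),
      IsAlmostPeriodicAtWithPhase G u (-1),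
      ∀ m : ℝ → ℤ,
        ∑ μ ∈ (eigenvalueSupport_finite G u).toFinset, (m μ : ℝ) * μ = 0 →
          Even (∑ μ ∈ (eigenvalueSupport_finite G u).toFinset, m μ)] := by
  have hexp (τ μ : ℝ) : Complex.exp (-(Complex.I * (2 * τ : ℝ)) * μ) =
      Complex.exp (-2 * Complex.I * μ * τ) := by
    push_cast; ring_nf
  tfae_have 1 ↔ 2 := by
    simp only [HasPGSTWithPhase, norm_neg, norm_one, true_and,
      tendsto_transitionMatrix_blowUp_two_iff, tendsto_transitionMatrix_apply_self_neg_one_iff,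
      hexp]
  tfae_have 1 → 3 := fun ⟨h, τ, hτ⟩ =>
    ⟨h, fun k => 2 * τ k, (tendsto_transitionMatrix_blowUp_two_iff G u τ).mp hτ⟩
  tfae_have 3 → 1 := fun ⟨h, τ, hτ⟩ =>
    ⟨h, fun k => τ k / 2, (tendsto_transitionMatrix_blowUp_two_iff G u _).mpr <| by
      simpa only [mul_div_cancel₀ _ (two_ne_zero' ℝ)] using hτ⟩
  tfae_have 2 → 4 := fun ⟨τ, hτ⟩ m hm =>
    even_sum_of_tendsto_exp_neg_one (fun μ hμ => hτ μ ((Set.Finite.mem_toFinset _).mp hμ)) hm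
  tfae_have 4 → 2 := fun h => by
    simpa only [Set.Finite.mem_toFinset] using exists_tendsto_exp_neg_one_of_even_sum h
  tfae_finish
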